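/- Let $n\ge 2$, $\sigma>0$, and let $\mu$ be a finite complex (in particular, possibly signed or positive) Borel measure on $\mathbb R^n$ with $\mu(\mathbb R^n)=1$ such that, with $\widehat\mu(\xi)=\int_{\mathbb R^n}e^{-i\langle x,\xi\rangle}\,d\mu(x)$, there are constants $a,b>0$ with $$a\min\{1,|\xi|^{2\sigma}\}\le|1-\widehat\mu(\xi)|\le b\min\{1,|\xi|^{2\sigma}\}\qquad\text{for all }\xi\in\mathbb R^n .$$ For $t>0$ and a complex-valued $f\in L^p(\mathbb R^n)$, $1\le p\le 2$, put $M^t_\mu f(x)=\int_{\mathbb R^n}f(x-ty)\,d\mu(y)$ (defined for almost every $x$). Let $\widehat f$ be the Fourier transform of $f$, given by $\widehat f(\xi)=\int_{\mathbb R^n}f(x)e^{-i\langle x,\xi\rangle}\,dx$ for $f\in L^1$ and extended in the usual way to $L^1+L^2\supseteq L^p$ (where it is determined almost everywhere). Let $p'$ be the conjugate exponent, $\frac1p+\frac1{p'}=1$. Then: 1. There is a constant $c_1>0$ such that for all $f\in L^1(\mathbb R^n)$ and all $t>0$, $$\sup_{\xi\in\mathbb R^n}\Big[\min\{1,(t|\xi|)^{2\sigma}\}\,|\widehat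 f(\xi)|\Big]\le c_1\,\|M^t_\mu f-f\|_1 .$$ 2. For every $1<p<2$ there is a constant $c_p>0$ such that for all $f\in L^p(\mathbb R^n)$ and all $t>0$, $$\Big[\int_{\mathbb R^n}\min\{1,(t|\xi|)^{2\sigma p'}\}\,|\widehat f(\xi)|^{p'}\,d\xi\Big]^{1/p'}\le c_p\,\|M^t_\mu f-f\|_p .$$ 3. There are constants $c,C>0$ such that for all $f\in L^2(\mathbb R^n)$ and all $t>0$, $$c\,\|M^t_\mu f-f\|_2\le\Big[\int_{\mathbb R^n}\min\{1,(t|\xi|)^{4\sigma}\}\,|\widehat f(\xi)|^{2}\,d\xi\Big]^{1/2}\le C\,\|M^t_\mu f-f\|_2 .$$ The constants may depend on $n,\sigma,\mu$ and (in 2.) $p$, but not on $f$ or $t$. -/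

import Mathlib

open MeasureTheory FourierTransform
open scoped ENNReal

noncomputable section

/-- Euclidean space of dimension `n`. -/
abbrev EucSp (n : ℕ) : Type := EuclideanSpace ℝ (Fin n)

/-- The Fourier transform of a complex (in particular, of a signed or positive finite) Borel measure:
`μ̂(ξ) = ∫ e^{-i⟨x, ξ⟩} dμ(x)`. -/
def measureFourier {n : ℕ} (μ : ComplexMeasure (EucSp n)) (ξ : EucSp n) : ℂ :=
  ∫ᵛ x, Complex.exp (-(Complex.I * ((inner ℝ x ξ : ℝ) : ℂ))) ∂[ContinuousLinearMap.mul ℝ ℂ; μ]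

/-- The class `K_σ`, for some `σ > 0`: finite (complex) Borel measures of total mass one with
`|1 - μ̂(ξ)| ≍ min {1, |ξ|^{2σ}}`. -/
structure IsClassK {n : ℕ} (σ : ℝ) (μ : ComplexMeasure (EucSp n)) : Prop where
  sigma_pos : 0 < σ
  mass_one : μ Set.univ = 1
  estimate : ∃ a b : ℝ, 0 < a ∧ 0 < b ∧ ∀ ξ : EucSp n,
    a * min 1 (‖ξ‖ ^ (2 * σ)) ≤ ‖1 - measureFourier μ ξ‖ ∧
    ‖1 - measureFourier μ ξ‖ ≤ b * min 1 (‖ξ‖ ^ (2 * σ))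

/-- The operator `M^t_μ f(x) = (f * μ_t)(x) = ∫ f(x - t y) dμ(y)`. -/
def dilatedMean {n : ℕ} (μ : ComplexMeasure (EucSp n)) (t : ℝ) (f : EucSp n → ℂ)
    (x : EucSp n) : ℂ :=
  ∫ᵛ y, f (x - t • y) ∂[ContinuousLinearMap.mul ℝ ℂ; μ]

/-- The Fourier transform `f̂(ξ) = ∫ e^{-i⟨x, ξ⟩} f(x) dx` of an integrable function. -/
def fourierLOne {n : ℕ} (f : EucSp n → ℂ) (ξ : EucSp n) : ℂ :=
  ∫ x, Complex.exp (-(Complex.I * ((inner ℝ x ξ : ℝ) : ℂ))) * f x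

open Classical in
/-- The `L²` (Plancherel) Fourier transform in the normalization of `fourierLOne`. Mathlib's
transform has the kernel `e^{-2πi⟨x, ξ⟩}`, whence the rescaling of the frequency. -/
def fourierLTwo {n : ℕ} (f : EucSp n → ℂ) (ξ : EucSp n) : ℂ :=
  if h : MemLp f 2 volume then
    ((𝓕 (h.toLp f) : Lp ℂ 2 (volume : Measure (EucSp n))) : EucSp n → ℂ) ((2 * Real.pi)⁻¹ • ξ)
  else 0

open Classical in
/-- The Fourier transform of `f ∈ L^p`, `1 ≤ p ≤ 2`. For an integrable `f` it is given by the
integral, at every point; in general it is the extension to `L¹ + L² ⊇ L^p`, computed on the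
decomposition of `f` into its large values (an `L¹` function) and its small ones (an `L²` function). -/
def fourierOfLp {n : ℕ} (f : EucSp n → ℂ) (ξ : EucSp n) : ℂ :=
  if Integrable f volume then fourierLOne f ξ
  else fourierLOne ({x | 1 < ‖f x‖}.indicator f) ξ + fourierLTwo ({x | ‖f x‖ ≤ 1}.indicator f) ξ

end

/-! Convolution becomes multiplication on the frequency side: the Fourier transform of `M^t_μ f - f`
is `(μ̂(tξ) - 1) f̂(ξ)`, and the hypothesis on `μ` says exactly that the modulus of this multiplier
is comparable to `min {1, (t|ξ|)^{2σ}}`. Each upper bound for the weighted `f̂` is therefore a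
mapping property of the Fourier transform applied to `M^t_μ f - f`: the trivial bound from `L¹` to
`L^∞`, Hausdorff–Young for `1 < p < 2`, and Plancherel for `p = 2`. Plancherel is an identity up to
a constant, so at `p = 2` the upper bound on the multiplier gives the reverse inequality.

Three ingredients carry this. Integration against `μ` is reduced to a unimodular density against a
finite positive measure (`exists_integral_eq`). The transform on `L¹ + L²` is handled through the
relation `IsFourierTransform`, which is independent of the decomposition
(`IsFourierTransform.unique`) and turns convolution into multiplication
(`IsFourierTransform.convolution`). Hausdorff–Young, without the sharp constant, is proved by real
interpolation: at each height of `f̂` the function is cut at a matching level, its large values are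
estimated from `L¹` to `L^∞`, its small ones by Plancherel, and the distribution function is
integrated (`IsFourierTransform.exists_eLpNorm_le`). -/

/-! ### Polar form of complex measures. -/

section ComplexMeasureDensity

variable {X : Type*} [MeasurableSpace X]

/-- From `|z| ≤ |Re z| + |Im z|` on each set; it serves to show that the variation is a finite
measure. -/
theorem MeasureTheory.ComplexMeasure.variation_le (μ : ComplexMeasure X) :
    μ.variation ≤ (ComplexMeasure.re μ).totalVariation + (ComplexMeasure.im μ).totalVariation := by
  refine VectorMeasure.variation_le_of_forall_enorm_le fun s _ => ?_
  have h : ‖μ s‖ₑ ≤ ‖(μ s).re‖ₑ + ‖(μ s).im‖ₑ := by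
    rw [← ofReal_norm, ← ofReal_norm, ← ofReal_norm,
      ← ENNReal.ofReal_add (norm_nonneg _) (norm_nonneg _)]
    exact ENNReal.ofReal_le_ofReal (Complex.norm_le_abs_re_add_abs_im _)
  exact h.trans (add_le_add ((ComplexMeasure.re μ).enorm_le_totalVariation s)
    ((ComplexMeasure.im μ).enorm_le_totalVariation s))

instance MeasureTheory.ComplexMeasure.isFiniteMeasure_variation (μ : ComplexMeasure X) :
    IsFiniteMeasure μ.variation :=
  isFiniteMeasure_of_le _ μ.variation_le

/-- The Radon–Nikodym theorem for complex measures. -/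
theorem MeasureTheory.ComplexMeasure.exists_withDensity_eq (μ : ComplexMeasure X) :
    ∃ φ : X → ℂ, Measurable φ ∧ Integrable φ μ.variation ∧
      μ.variation.withDensityᵥ φ = μ := by
  have hac : μ ≪ᵥ μ.variation.toENNRealVectorMeasure := by
    refine VectorMeasure.AbsolutelyContinuous.mk fun s hs h0 => ?_
    rw [Measure.toENNRealVectorMeasure_apply_measurable hs] at h0
    have := VectorMeasure.enorm_measure_le_variation μ s
    rw [h0] at this
    simpa using this
  obtain ⟨hre, him⟩ := (ComplexMeasure.absolutelyContinuous_ennreal_iff _ _).1 hac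
  have h1 := SignedMeasure.withDensityᵥ_rnDeriv_eq _ _ hre
  have h2 := SignedMeasure.withDensityᵥ_rnDeriv_eq _ _ him
  set u := (ComplexMeasure.re μ).rnDeriv μ.variation
  set v := (ComplexMeasure.im μ).rnDeriv μ.variation
  have hu : Integrable u μ.variation := SignedMeasure.integrable_rnDeriv _ _
  have hv : Integrable v μ.variation := SignedMeasure.integrable_rnDeriv _ _
  have hum : Measurable u := SignedMeasure.measurable_rnDeriv _ _
  have hvm : Measurable v := SignedMeasure.measurable_rnDeriv _ _
  have hint : Integrable (fun x => (u x : ℂ) + v x * Complex.I) μ.variation :=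
    hu.ofReal.add (hv.ofReal.mul_const _)
  refine ⟨fun x => u x + v x * Complex.I, by fun_prop, hint, ?_⟩
  ext s hs
  have hu' : Integrable (fun x => (u x : ℂ)) (μ.variation.restrict s) := hu.ofReal.restrict
  have hv' : Integrable (fun x => (v x : ℂ) * Complex.I) (μ.variation.restrict s) :=
    (hv.ofReal.mul_const _).restrict
  rw [withDensityᵥ_apply hint hs, integral_add hu' hv', integral_mul_const, integral_complex_ofReal,
    integral_complex_ofReal,
    ← withDensityᵥ_apply hu hs, ← withDensityᵥ_apply hv hs, h1, h2]
  exact Complex.re_add_im _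

/-- The polar decomposition of a complex measure. -/
theorem MeasureTheory.ComplexMeasure.exists_polar (μ : ComplexMeasure X) :
    ∃ φ : X → ℂ, Measurable φ ∧ (∀ x, ‖φ x‖ = 1) ∧ μ.variation.withDensityᵥ φ = μ := by
  obtain ⟨φ, hφ, hint, h⟩ := μ.exists_withDensity_eq
  -- The variation of `φ d|μ|` is `|φ| d|μ|`, and it must equal `|μ|` itself; uniqueness of
  -- densities then gives `|φ| = 1` almost everywhere.
  have hvar : μ.variation.withDensity (fun x => ‖φ x‖ₑ) = μ.variation.withDensity 1 := by
    rw [← Measure.variation_withDensityᵥ hint, h, withDensity_one]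
  have hae : (fun x => ‖φ x‖ₑ) =ᵐ[μ.variation] 1 :=
    (withDensity_eq_iff hφ.enorm.aemeasurable (by fun_prop) hint.2.ne).1 hvar
  classical
  have hs : MeasurableSet {x | ‖φ x‖ = 1} := hφ.norm (measurableSet_singleton 1)
  -- Resetting `φ` to `1` on a null set makes it unimodular at every point.
  refine ⟨{x | ‖φ x‖ = 1}.piecewise φ (fun _ => 1), hφ.piecewise hs measurable_const,
    fun x => ?_, ?_⟩
  · by_cases hx : ‖φ x‖ = 1
    · rw [Set.piecewise_eq_of_mem _ _ _ (show x ∈ {x | ‖φ x‖ = 1} from hx), hx]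
    · rw [Set.piecewise_eq_of_notMem _ _ _ (show x ∉ {x | ‖φ x‖ = 1} from hx), norm_one]
  · refine (WithDensityᵥEq.congr_ae ?_).trans h
    filter_upwards [hae] with x hx
    have hx' : ‖φ x‖ = 1 := by
      rw [← toReal_enorm, hx]; simp
    exact Set.piecewise_eq_of_mem _ _ _ hx'

/-- Integration against a complex measure is integration against its variation with the polar
density. -/
theorem MeasureTheory.ComplexMeasure.exists_integral_eq (μ : ComplexMeasure X) :
    ∃ φ : X → ℂ, Measurable φ ∧ (∀ x, ‖φ x‖ = 1) ∧ ∀ f : X → ℂ,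
      ∫ᵛ x, f x ∂[ContinuousLinearMap.mul ℝ ℂ; μ] = ∫ x, φ x * f x ∂μ.variation := by
  obtain ⟨φ, hφ, hnorm, h⟩ := μ.exists_polar
  have hint : Integrable φ μ.variation :=
    Integrable.of_bound hφ.aestronglyMeasurable 1 (by simp [hnorm])
  have hmul : ∀ {f : X → ℂ}, Integrable f μ.variation →
      Integrable (fun x => φ x * f x) μ.variation := fun hf =>
    hf.bdd_mul (c := 1) hφ.aestronglyMeasurable (by simp [hnorm])
  refine ⟨φ, hφ, hnorm, fun f => ?_⟩
  by_cases hf : Integrable f μ.variation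
  · refine Integrable.induction (P := fun f => ∫ᵛ x, f x ∂[ContinuousLinearMap.mul ℝ ℂ; μ] =
      ∫ x, φ x * f x ∂μ.variation) ?_ ?_ ?_ ?_ hf
    · intro c s hs hμs
      rw [VectorMeasure.integral_indicator_const _ hs]
      have : (fun x => φ x * s.indicator (fun _ => c) x) = s.indicator (fun x => φ x * c) := by
        ext x; by_cases hx : x ∈ s <;> simp [hx]
      rw [this, integral_indicator hs, integral_mul_const, ← withDensityᵥ_apply hint hs, h]
      simp [mul_comm]
    · intro f g hd hf hg ihf ihg
      simp only [Pi.add_apply, mul_add]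
      rw [VectorMeasure.integral_fun_add hf hg, ihf, ihg, integral_add (hmul hf) (hmul hg)]
    · refine isClosed_eq VectorMeasure.continuous_integral ?_
      refine continuous_iff_continuousAt.2 fun g => ?_
      refine tendsto_integral_of_L1 _ (hmul (L1.integrable_coeFn g)).1
        (.of_forall fun k => hmul (L1.integrable_coeFn k)) ?_
      have : Filter.Tendsto (fun k : X →₁[μ.variation] ℂ => ‖k - g‖ₑ) (nhds g) (nhds 0) := by
        have : Continuous (fun k : X →₁[μ.variation] ℂ => ‖k - g‖ₑ) := by fun_prop
        simpa using this.tendsto g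
      refine this.congr fun k => ?_
      rw [Lp.enorm_def, eLpNorm_one_eq_lintegral_enorm]
      refine lintegral_congr_ae ?_
      filter_upwards [Lp.coeFn_sub k g] with x hx
      rw [hx, Pi.sub_apply, ← mul_sub, enorm_mul, ← ofReal_norm (φ x), hnorm]
      simp
    · intro f g hfg hf ih
      rw [← VectorMeasure.integral_congr_ae hfg, ih]
      refine integral_congr_ae ?_
      filter_upwards [hfg] with x hx
      rw [hx]
  -- For non-integrable `f` both integrals take the default value `0`: a unimodular factor does not
  -- affect integrability. Hence the identity needs no hypothesis on `f`.
  · rw [VectorMeasure.integral_undef hf, integral_undef]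
    intro hf'
    refine hf ?_
    have := hf'.bdd_mul (c := 1) (f := fun x => (φ x)⁻¹) hφ.inv.aestronglyMeasurable
      (by simp [hnorm])
    refine this.congr (.of_forall fun x => ?_)
    have : φ x ≠ 0 := by rw [← norm_ne_zero_iff, hnorm]; exact one_ne_zero
    simp [this]

end ComplexMeasureDensity

/-! ### Agreement of the `L¹` and `L²` Fourier transforms. -/

section FourierConsistency

variable {V : Type*} [NormedAddCommGroup V] [InnerProductSpace ℝ V] [FiniteDimensional ℝ V]
  [MeasurableSpace V] [BorelSpace V]

theorem Real.continuous_fourier_of_integrable {g : V → ℂ} (hg : Integrable g) :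
    Continuous (𝓕 g) :=
  VectorFourier.fourierIntegral_continuous Real.continuous_fourierChar
    (by simpa using! continuous_inner) hg

/-- The `L²` Fourier transform is given by the Fourier integral on integrable functions. -/
theorem MeasureTheory.Lp.coeFn_fourier_toLp {g : V → ℂ} (h1 : Integrable g) (h2 : MemLp g 2) :
    ((𝓕 (h2.toLp g) : Lp ℂ 2 (volume : Measure V)) : V → ℂ) =ᵐ[volume] 𝓕 g := by
  refine ae_eq_of_integral_contDiff_smul_eq
    ((Lp.memLp _).locallyIntegrable (by norm_num))
    (Real.continuous_fourier_of_integrable h1).locallyIntegrable fun u hu hc => ?_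
  have hc' : HasCompactSupport (Complex.ofRealCLM ∘ u) := hc.comp_left rfl
  have hu' : ContDiff ℝ ((⊤ : ℕ∞) : WithTop ℕ∞) (Complex.ofRealCLM ∘ u) :=
    Complex.ofRealCLM.contDiff.comp hu
  -- A smooth compactly supported test function is a Schwartz function, so both transforms can be
  -- paired with it: the `L²` one as a tempered distribution, the integral one by Fubini. Both
  -- pairings equal `∫ g 𝓕ψ`.
  set ψ : SchwartzMap V ℂ := hc'.toSchwartzMap hu' with hψ
  have hψu : ∀ x, ψ x = u x := fun x => by simp [hψ]
  have key := congrArg (fun T => T ψ) (Lp.fourier_toTemperedDistribution_eq (h2.toLp g))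
  simp only [TemperedDistribution.fourier_apply, Lp.toTemperedDistribution_apply] at key
  have e1 : ∫ x, u x • (𝓕 (h2.toLp g) : Lp ℂ 2 (volume : Measure V)) x =
      ∫ x, ψ x • (𝓕 (h2.toLp g) : Lp ℂ 2 (volume : Measure V)) x := by
    simp only [hψu, Complex.real_smul, smul_eq_mul]
  have e2 : ∫ x, u x • 𝓕 g x = ∫ x, 𝓕 g x • ψ x := by
    simp only [hψu, Complex.real_smul, smul_eq_mul, mul_comm]
  have e3 : ∫ x, 𝓕 g x • ψ x = ∫ x, g x • 𝓕 ψ x := by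
    simpa using! VectorFourier.integral_fourierIntegral_smul_eq_flip (L := innerₗ V)
      Real.continuous_fourierChar continuous_inner h1 ψ.integrable
  rw [e1, ← key, e2, e3]
  refine integral_congr_ae ?_
  filter_upwards [h2.coeFn_toLp] with x hx
  rw [hx, smul_eq_mul, smul_eq_mul, mul_comm]

end FourierConsistency

/-! ### The Fourier transform on `L¹ + L²`. -/

section FourierLp

variable {n : ℕ}

theorem fourierLOne_eq (f : EucSp n → ℂ) (ξ : EucSp n) :
    fourierLOne f ξ = 𝓕 f ((2 * Real.pi)⁻¹ • ξ) := by
  rw [Real.fourier_eq', fourierLOne]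
  refine integral_congr_ae (.of_forall fun x => ?_)
  simp only [inner_smul_right, smul_eq_mul]
  congr 2
  have : (-2 * Real.pi * ((2 * Real.pi)⁻¹ * inner ℝ x ξ) : ℝ) = -inner ℝ x ξ := by
    field_simp
  rw [this]
  push_cast
  ring

theorem integrable_exp_mul {f : EucSp n → ℂ} (hf : Integrable f) (ξ : EucSp n) :
    Integrable fun x => Complex.exp (-(Complex.I * ((inner ℝ x ξ : ℝ) : ℂ))) * f x := by
  refine hf.bdd_mul (c := 1) (by fun_prop) (.of_forall fun x => ?_)
  simp [Complex.norm_exp]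

theorem fourierLOne_sub {f g : EucSp n → ℂ} (hf : Integrable f) (hg : Integrable g) :
    fourierLOne (f - g) = fourierLOne f - fourierLOne g := by
  ext ξ
  simp only [fourierLOne, Pi.sub_apply, mul_sub]
  exact integral_sub (integrable_exp_mul hf ξ) (integrable_exp_mul hg ξ)

theorem norm_fourierLOne_le (f : EucSp n → ℂ) (ξ : EucSp n) :
    ‖fourierLOne f ξ‖ ≤ ∫ x, ‖f x‖ := by
  refine (norm_integral_le_integral_norm _).trans_eq ?_
  simp [Complex.norm_exp]

theorem enorm_fourierLOne_le (f : EucSp n → ℂ) (ξ : EucSp n) :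
    ‖fourierLOne f ξ‖ₑ ≤ eLpNorm f 1 volume := by
  rw [eLpNorm_one_eq_lintegral_enorm]
  refine (enorm_integral_le_lintegral_enorm _).trans_eq ?_
  refine lintegral_congr fun x => ?_
  rw [enorm_mul, ← ofReal_norm (Complex.exp _)]
  simp [Complex.norm_exp]

theorem continuous_fourierLOne {f : EucSp n → ℂ} (hf : Integrable f) :
    Continuous (fourierLOne f) := by
  have : fourierLOne f = fun ξ => 𝓕 f ((2 * Real.pi)⁻¹ • ξ) := funext (fourierLOne_eq f)
  rw [this]
  exact (Real.continuous_fourier_of_integrable hf).comp (continuous_const_smul _)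

theorem quasiMeasurePreserving_two_pi_inv_smul :
    Measure.QuasiMeasurePreserving (fun ξ : EucSp n => (2 * Real.pi)⁻¹ • ξ) volume volume :=
  Measure.quasiMeasurePreserving_smul volume (by positivity)

theorem fourierLTwo_of_memLp {f : EucSp n → ℂ} (hf : MemLp f 2 volume) :
    fourierLTwo f = fun ξ =>
      (𝓕 (hf.toLp f) : Lp ℂ 2 (volume : Measure (EucSp n))) ((2 * Real.pi)⁻¹ • ξ) := by
  ext ξ
  rw [fourierLTwo, dif_pos hf]

theorem aestronglyMeasurable_fourierLTwo {f : EucSp n → ℂ} (hf : MemLp f 2 volume) :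
    AEStronglyMeasurable (fourierLTwo f) volume := by
  rw [fourierLTwo_of_memLp hf]
  exact (Lp.aestronglyMeasurable _).comp_quasiMeasurePreserving
    quasiMeasurePreserving_two_pi_inv_smul

theorem fourierLTwo_congr {f g : EucSp n → ℂ} (hf : MemLp f 2 volume) (h : f =ᵐ[volume] g) :
    fourierLTwo f = fourierLTwo g := by
  rw [fourierLTwo_of_memLp hf, fourierLTwo_of_memLp ((memLp_congr_ae h).1 hf),
    MemLp.toLp_congr hf ((memLp_congr_ae h).1 hf) h]

theorem fourierLTwo_add {f g : EucSp n → ℂ} (hf : MemLp f 2 volume) (hg : MemLp g 2 volume) :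
    fourierLTwo (f + g) =ᵐ[volume] fourierLTwo f + fourierLTwo g := by
  rw [fourierLTwo_of_memLp hf, fourierLTwo_of_memLp hg, fourierLTwo_of_memLp (hf.add hg),
    MemLp.toLp_add hf hg, FourierAdd.fourier_add]
  exact quasiMeasurePreserving_two_pi_inv_smul.ae_eq_comp (Lp.coeFn_add _ _)

theorem fourierLTwo_sub {f g : EucSp n → ℂ} (hf : MemLp f 2 volume) (hg : MemLp g 2 volume) :
    fourierLTwo (f - g) =ᵐ[volume] fourierLTwo f - fourierLTwo g := by
  have h := fourierLTwo_add (hf.sub hg) hg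
  rw [sub_add_cancel] at h
  filter_upwards [h] with ξ hξ
  simp only [Pi.sub_apply, Pi.add_apply] at *
  rw [hξ, add_sub_cancel_right]

theorem fourierLTwo_ae_eq_fourierLOne {f : EucSp n → ℂ} (h1 : Integrable f)
    (h2 : MemLp f 2 volume) : fourierLTwo f =ᵐ[volume] fourierLOne f := by
  rw [fourierLTwo_of_memLp h2, show fourierLOne f = fun ξ => 𝓕 f ((2 * Real.pi)⁻¹ • ξ) from
    funext (fourierLOne_eq f)]
  exact quasiMeasurePreserving_two_pi_inv_smul.ae_eq_comp (Lp.coeFn_fourier_toLp h1 h2)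

/-- The constant `(2π)^{n/2}` of the Plancherel identity. -/
noncomputable def plancherelConst (n : ℕ) : ℝ≥0∞ :=
  ENNReal.ofReal |(((2 * Real.pi)⁻¹ : ℝ) ^ n)⁻¹| ^ (1 / 2 : ℝ)

theorem plancherelConst_ne_zero (n : ℕ) : plancherelConst n ≠ 0 := by
  have : 0 < ENNReal.ofReal |(((2 * Real.pi)⁻¹ : ℝ) ^ n)⁻¹| :=
    ENNReal.ofReal_pos.2 (abs_pos.2 (by positivity))
  exact (ENNReal.rpow_pos this ENNReal.ofReal_ne_top).ne'

theorem plancherelConst_ne_top (n : ℕ) : plancherelConst n ≠ ∞ :=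
  ENNReal.rpow_ne_top_of_nonneg (by norm_num) ENNReal.ofReal_ne_top

/-- **Plancherel's theorem** in the normalization of `fourierLOne`. -/
theorem eLpNorm_fourierLTwo {f : EucSp n → ℂ} (hf : MemLp f 2 volume) :
    eLpNorm (fourierLTwo f) 2 volume = plancherelConst n * eLpNorm f 2 volume := by
  have hr : ((2 * Real.pi)⁻¹ : ℝ) ≠ 0 := by positivity
  set G : Lp ℂ 2 (volume : Measure (EucSp n)) := 𝓕 (hf.toLp f) with hG
  have hGn : eLpNorm G 2 volume = eLpNorm f 2 volume := by
    rw [← Lp.enorm_def, ← ofReal_norm, hG, Lp.norm_fourier_eq, ofReal_norm, Lp.enorm_toLp]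
  rw [fourierLTwo_of_memLp hf, ← hG]
  -- The frequency dilation multiplies Lebesgue measure by `(2π)^n`; in the `L²` norm this becomes
  -- its square root.
  have h := eLpNorm_map_measure (p := 2) (μ := (volume : Measure (EucSp n)))
    (f := fun ξ => (2 * Real.pi)⁻¹ • ξ) (g := G) (by
      rw [Measure.map_addHaar_smul volume hr]
      exact (Lp.aestronglyMeasurable G).smul_measure _) (by fun_prop)
  rw [Measure.map_addHaar_smul volume hr, eLpNorm_smul_measure_of_ne_top (by norm_num), hGn] at h
  rw [Function.comp_def] at h
  rw [← h, plancherelConst, smul_eq_mul]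
  simp

/-- `F` is a version of the Fourier transform of `f ∈ L¹ + L²`. -/
def IsFourierTransform (f F : EucSp n → ℂ) : Prop :=
  ∃ g h : EucSp n → ℂ, Integrable g ∧ MemLp h 2 volume ∧ f =ᵐ[volume] g + h ∧
    F =ᵐ[volume] fourierLOne g + fourierLTwo h

/-- Two decompositions of `f` differ by `g - g' = k' - k`, a function in `L¹ ∩ L²`, where the two
transforms agree. This allows a different decomposition at each height in the Hausdorff–Young
argument. -/
theorem IsFourierTransform.unique {f F F' : EucSp n → ℂ} (h : IsFourierTransform f F)
    (h' : IsFourierTransform f F') : F =ᵐ[volume] F' := by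
  obtain ⟨g, k, hg, hk, hf, hF⟩ := h
  obtain ⟨g', k', hg', hk', hf', hF'⟩ := h'
  have hae : g - g' =ᵐ[volume] k' - k := by
    filter_upwards [hf, hf'] with x h1 h2
    simp only [Pi.add_apply, Pi.sub_apply] at *
    rw [sub_eq_sub_iff_add_eq_add, ← h1, h2, add_comm]
  have h2 : MemLp (g - g') 2 volume := (memLp_congr_ae hae).2 (hk'.sub hk)
  have e1 := fourierLTwo_ae_eq_fourierLOne (hg.sub hg') h2
  rw [fourierLTwo_congr h2 hae, fourierLOne_sub hg hg'] at e1
  filter_upwards [hF, hF', e1, fourierLTwo_sub hk' hk] with ξ a b c d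
  simp only [Pi.add_apply, Pi.sub_apply] at *
  rw [d, sub_eq_sub_iff_add_eq_add] at c
  rw [a, b, ← c, add_comm]

theorem IsFourierTransform.sub {f F f' F' : EucSp n → ℂ} (h : IsFourierTransform f F)
    (h' : IsFourierTransform f' F') : IsFourierTransform (f - f') (F - F') := by
  obtain ⟨g, k, hg, hk, hf, hF⟩ := h
  obtain ⟨g', k', hg', hk', hf', hF'⟩ := h'
  refine ⟨g - g', k - k', hg.sub hg', hk.sub hk', ?_, ?_⟩
  · filter_upwards [hf, hf'] with x h1 h2
    simp only [Pi.add_apply, Pi.sub_apply] at *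
    rw [h1, h2]; ring
  · rw [fourierLOne_sub hg hg']
    filter_upwards [hF, hF', fourierLTwo_sub hk hk'] with x h1 h2 h3
    simp only [Pi.add_apply, Pi.sub_apply] at *
    rw [h1, h2, h3]; ring

theorem IsFourierTransform.aestronglyMeasurable {f F : EucSp n → ℂ}
    (h : IsFourierTransform f F) : AEStronglyMeasurable F volume := by
  obtain ⟨g, k, hg, hk, -, hF⟩ := h
  exact ((continuous_fourierLOne hg).aestronglyMeasurable.add
    (aestronglyMeasurable_fourierLTwo hk)).congr hF.symm

theorem isFourierTransform_fourierLTwo {f : EucSp n → ℂ} (hf : MemLp f 2 volume) :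
    IsFourierTransform f (fourierLTwo f) := by
  refine ⟨0, f, integrable_zero _ _ _, hf, by rw [zero_add], ?_⟩
  have : fourierLOne (0 : EucSp n → ℂ) = 0 := by ext ξ; simp [fourierLOne]
  rw [this, zero_add]

theorem isFourierTransform_fourierLOne {f : EucSp n → ℂ} (hf : Integrable f) :
    IsFourierTransform f (fourierLOne f) := by
  refine ⟨f, 0, hf, MemLp.zero, by rw [add_zero], ?_⟩
  have h0 : fourierLTwo (0 : EucSp n → ℂ) =ᵐ[volume] fourierLOne (0 : EucSp n → ℂ) :=
    fourierLTwo_ae_eq_fourierLOne (integrable_zero _ _ _) MemLp.zero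
  filter_upwards [h0] with ξ hξ
  rw [Pi.add_apply, hξ]
  simp [fourierLOne]

/-! ### Cutting an `L^p` function into large and small values. -/

section Truncation

variable {α : Type*} {f : α → ℂ} {p : ℝ}

/-- Where `|f| > a`, write `|f| = |f|^{1-p} |f|^p` and use `1 - p ≤ 0`. -/
theorem norm_indicator_large_le (hp : 1 ≤ p) {a : ℝ} (ha : 0 < a) (x : α) :
    ‖{x | a < ‖f x‖}.indicator f x‖ ≤ a ^ (1 - p) * ‖f x‖ ^ p := by
  by_cases hx : a < ‖f x‖
  · rw [Set.indicator_of_mem (show x ∈ {x | a < ‖f x‖} from hx)]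
    have h0 : 0 < ‖f x‖ := ha.trans hx
    calc ‖f x‖ = ‖f x‖ ^ (1 - p) * ‖f x‖ ^ p := by
          rw [← Real.rpow_add h0]; simp
      _ ≤ a ^ (1 - p) * ‖f x‖ ^ p := by
          gcongr ?_ * _
          exact Real.rpow_le_rpow_of_nonpos ha hx.le (by linarith)
  · rw [Set.indicator_of_notMem (show x ∉ {x | a < ‖f x‖} from hx), norm_zero]
    positivity

theorem norm_indicator_small_sq_le (hp0 : 0 < p) (hp : p ≤ 2) {a : ℝ} (ha : 0 < a)
    (x : α) :
    ‖{x | ‖f x‖ ≤ a}.indicator f x‖ ^ 2 ≤ a ^ (2 - p) * ‖f x‖ ^ p := by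
  by_cases hx : ‖f x‖ ≤ a
  · rw [Set.indicator_of_mem (show x ∈ {x | ‖f x‖ ≤ a} from hx)]
    rcases (norm_nonneg (f x)).eq_or_lt with h0 | h0
    · rw [← h0, Real.zero_rpow hp0.ne']; simp
    · calc ‖f x‖ ^ 2 = ‖f x‖ ^ (2 - p) * ‖f x‖ ^ p := by
            rw [← Real.rpow_add h0]; simp
        _ ≤ a ^ (2 - p) * ‖f x‖ ^ p := by
            gcongr ?_ * _
            exact Real.rpow_le_rpow h0.le hx (by linarith)
  · rw [Set.indicator_of_notMem (show x ∉ {x | ‖f x‖ ≤ a} from hx), norm_zero,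
      zero_pow two_ne_zero]
    positivity

theorem indicator_large_add_small (f : α → ℂ) (a : ℝ) :
    {x | a < ‖f x‖}.indicator f + {x | ‖f x‖ ≤ a}.indicator f = f := by
  ext x
  by_cases hx : a < ‖f x‖
  · simp [Set.indicator, hx, hx.not_ge]
  · simp [Set.indicator, hx, not_lt.1 hx]

variable [MeasurableSpace α] {ν : Measure α}

theorem MeasureTheory.MemLp.integrable_rpow (hp : 0 < p) (hf : MemLp f (ENNReal.ofReal p) ν) :
    Integrable (fun x => ‖f x‖ ^ p) ν := by
  have := hf.integrable_norm_rpow (by simpa using hp) ENNReal.ofReal_ne_top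
  rwa [ENNReal.toReal_ofReal hp.le] at this

theorem aestronglyMeasurable_indicator_large (hf : AEStronglyMeasurable f ν) (a : ℝ) :
    AEStronglyMeasurable ({x | a < ‖f x‖}.indicator f) ν :=
  hf.indicator₀ (nullMeasurableSet_lt aemeasurable_const hf.norm.aemeasurable)

theorem aestronglyMeasurable_indicator_small (hf : AEStronglyMeasurable f ν) (a : ℝ) :
    AEStronglyMeasurable ({x | ‖f x‖ ≤ a}.indicator f) ν :=
  hf.indicator₀ (nullMeasurableSet_le hf.norm.aemeasurable aemeasurable_const)

theorem MeasureTheory.MemLp.integrable_indicator_large (hp : 1 ≤ p)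
    (hf : MemLp f (ENNReal.ofReal p) ν) {a : ℝ} (ha : 0 < a) :
    Integrable ({x | a < ‖f x‖}.indicator f) ν :=
  ((hf.integrable_rpow (by linarith)).const_mul _).mono'
    (aestronglyMeasurable_indicator_large hf.1 a) (.of_forall (norm_indicator_large_le hp ha))

theorem MeasureTheory.MemLp.memLp_two_indicator_small (hp0 : 0 < p) (hp : p ≤ 2)
    (hf : MemLp f (ENNReal.ofReal p) ν) {a : ℝ} (ha : 0 < a) :
    MemLp ({x | ‖f x‖ ≤ a}.indicator f) 2 ν := by
  have hm := aestronglyMeasurable_indicator_small hf.1 a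
  rw [memLp_two_iff_integrable_sq_norm hm]
  refine ((hf.integrable_rpow hp0).const_mul (a ^ (2 - p))).mono' (hm.norm.pow 2)
    (.of_forall fun x => ?_)
  rw [Real.norm_of_nonneg (by positivity)]
  exact norm_indicator_small_sq_le hp0 hp ha x

end Truncation

theorem isFourierTransform_fourierOfLp {p : ℝ} (hp1 : 1 ≤ p) (hp2 : p ≤ 2) {f : EucSp n → ℂ}
    (hf : MemLp f (ENNReal.ofReal p) volume) : IsFourierTransform f (fourierOfLp f) := by
  by_cases hi : Integrable f
  · have : fourierOfLp f = fourierLOne f := by ext ξ; rw [fourierOfLp, if_pos hi]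
    rw [this]
    exact isFourierTransform_fourierLOne hi
  · refine ⟨_, _, hf.integrable_indicator_large hp1 one_pos,
      hf.memLp_two_indicator_small (by linarith) hp2 one_pos,
      .of_forall fun x => congrFun (indicator_large_add_small f 1).symm x,
      .of_forall fun ξ => ?_⟩
    rw [fourierOfLp, if_neg hi, Pi.add_apply]

end FourierLp

/-! ### The Hausdorff–Young inequality by real interpolation. -/

section HausdorffYoung

variable {n : ℕ}

theorem eLpNorm_two_sq {α : Type*} [MeasurableSpace α] {ν : Measure α} (f : α → ℂ) :
    eLpNorm f 2 ν ^ 2 = ∫⁻ x, ‖f x‖ₑ ^ 2 ∂ν := by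
  rw [eLpNorm_eq_lintegral_rpow_enorm_toReal (by norm_num) (by norm_num)]
  simp only [ENNReal.toReal_ofNat, ENNReal.rpow_ofNat]
  rw [← ENNReal.rpow_natCast, ← ENNReal.rpow_mul]
  norm_num

theorem lintegral_fourierLTwo_sq {h : EucSp n → ℂ} (hh : MemLp h 2 volume) :
    ∫⁻ ξ, ‖fourierLTwo h ξ‖ₑ ^ 2 = plancherelConst n ^ 2 * ∫⁻ x, ‖h x‖ₑ ^ 2 := by
  rw [← eLpNorm_two_sq, ← eLpNorm_two_sq, eLpNorm_fourierLTwo hh, mul_pow]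

theorem IsFourierTransform.congr_left {f f' F : EucSp n → ℂ} (h : IsFourierTransform f F)
    (hf : f =ᵐ[volume] f') : IsFourierTransform f' F := by
  obtain ⟨g, k, hg, hk, h1, h2⟩ := h
  exact ⟨g, k, hg, hk, hf.symm.trans h1, h2⟩

/-- The distribution function of the Fourier transform is controlled by the small values. -/
theorem IsFourierTransform.meas_lt_le {p : ℝ} (hp1 : 1 < p) (hp2 : p ≤ 2) {f F : EucSp n → ℂ}
    (hf : MemLp f (ENNReal.ofReal p) volume) (hF : IsFourierTransform f F) {a l : ℝ}
    (ha : 0 < a) (hl : 0 < l) (hal : a ^ (1 - p) * ∫ x, ‖f x‖ ^ p ≤ l / 2) :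
    volume {ξ | l < ‖F ξ‖} ≤ plancherelConst n ^ 2 * ENNReal.ofReal (4 * l ^ (-2 : ℝ)) *
      ∫⁻ x, ‖{x | ‖f x‖ ≤ a}.indicator f x‖ₑ ^ 2 := by
  have hg := hf.integrable_indicator_large hp1.le ha
  have hh := hf.memLp_two_indicator_small (by linarith) hp2 ha
  set g := {x | a < ‖f x‖}.indicator f with hgdef
  set h := {x | ‖f x‖ ≤ a}.indicator f with hhdef
  have hF' : F =ᵐ[volume] fourierLOne g + fourierLTwo h :=
    hF.unique ⟨g, h, hg, hh, .of_forall fun x =>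
      congrFun (indicator_large_add_small f a).symm x, .rfl⟩
  have hg1 : ∫ x, ‖g x‖ ≤ l / 2 := by
    refine le_trans ?_ hal
    rw [← integral_const_mul]
    exact integral_mono hg.norm ((hf.integrable_rpow (by linarith)).const_mul _)
      (norm_indicator_large_le hp1.le ha)
  have hε : ENNReal.ofReal (l / 2) ^ 2 ≠ 0 := by
    have : ENNReal.ofReal (l / 2) ≠ 0 := by simpa using hl
    exact pow_ne_zero _ this
  have hε' : ENNReal.ofReal (l / 2) ^ 2 ≠ ∞ := ENNReal.pow_ne_top ENNReal.ofReal_ne_top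
  calc volume {ξ | l < ‖F ξ‖}
      ≤ volume {ξ | ENNReal.ofReal (l / 2) ^ 2 ≤ ‖fourierLTwo h ξ‖ₑ ^ 2} := by
        -- The large part contributes at most `l / 2` at every frequency, so `|F| > l` forces the
        -- transform of the small part to be at least `l / 2`; Chebyshev and Plancherel finish.
        refine measure_mono_ae ?_
        filter_upwards [hF'] with ξ hξ hlt
        have hlt' : l < ‖F ξ‖ := hlt
        rw [hξ, Pi.add_apply] at hlt'
        have h1 := norm_add_le (fourierLOne g ξ) (fourierLTwo h ξ)
        have h2 := norm_fourierLOne_le g ξ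
        change ENNReal.ofReal (l / 2) ^ 2 ≤ ‖fourierLTwo h ξ‖ₑ ^ 2
        gcongr
        rw [← ofReal_norm]
        exact ENNReal.ofReal_le_ofReal (by linarith)
    _ ≤ (∫⁻ ξ, ‖fourierLTwo h ξ‖ₑ ^ 2) / ENNReal.ofReal (l / 2) ^ 2 :=
        meas_ge_le_lintegral_div ((aestronglyMeasurable_fourierLTwo hh).enorm.pow_const 2) hε hε'
    _ = _ := by
        have e : (ENNReal.ofReal (l / 2) ^ 2)⁻¹ = ENNReal.ofReal (4 * l ^ (-2 : ℝ)) := by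
          rw [← ENNReal.ofReal_pow (by positivity), ← ENNReal.ofReal_inv_of_pos (by positivity)]
          congr 1
          rw [Real.rpow_neg hl.le, Real.rpow_ofNat]
          field_simp
          norm_num
        rw [lintegral_fourierLTwo_sq hh, div_eq_mul_inv, e]
        ring

theorem lintegral_Ioc_rpow {b r : ℝ} (hb : 0 ≤ b) (hr : -1 < r) :
    ∫⁻ l in Set.Ioc 0 b, ENNReal.ofReal (l ^ r) = ENNReal.ofReal (b ^ (r + 1) / (r + 1)) := by
  have hint : IntervalIntegrable (fun l : ℝ => l ^ r) volume 0 b :=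
    intervalIntegral.intervalIntegrable_rpow' hr
  rw [← ofReal_integral_eq_lintegral_ofReal hint.1
    ((ae_restrict_iff' measurableSet_Ioc).2 (.of_forall fun l hl => Real.rpow_nonneg hl.1.le r)),
    ← intervalIntegral.integral_of_le hb, integral_rpow (Or.inl hr),
    Real.zero_rpow (by linarith), sub_zero]

/-- The condition on `y` amounts to `l ≤ 2 N y^{1-p}`, so for `y > 0` a power of `l` is integrated
over a bounded interval. The resulting power of `y` is `2 + (1-p)(q-2)`, which equals `p` because
`(p-1)(q-1) = 1`. -/
theorem lintegral_Ioi_indicator_small_le {p q N y : ℝ} (hp1 : 1 < p) (hp2 : p < 2)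
    (hpq : (p - 1) * (q - 1) = 1) (hN : 0 < N) (hy : 0 ≤ y) :
    ∫⁻ l in Set.Ioi (0 : ℝ), ENNReal.ofReal (l ^ (q - 3)) *
        (if y ≤ (l / (2 * N)) ^ (-(p - 1)⁻¹) then ENNReal.ofReal (y ^ 2) else 0) ≤
      ENNReal.ofReal ((2 * N) ^ (q - 2) / (q - 2) * y ^ p) := by
  have hp : 0 < p - 1 := by linarith
  have hq : 2 < q := by nlinarith
  rcases hy.eq_or_lt with rfl | hy
  · simp
  set b : ℝ := 2 * N * y ^ (1 - p) with hb
  have hb0 : 0 < b := by positivity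
  calc _ ≤ ∫⁻ l in Set.Ioi (0 : ℝ), (Set.Ioc 0 b).indicator
        (fun l => ENNReal.ofReal (y ^ 2) * ENNReal.ofReal (l ^ (q - 3))) l := by
        refine setLIntegral_mono' measurableSet_Ioi fun l hl => ?_
        have hl : 0 < l := hl
        split_ifs with h
        · have hlb : l ≤ b := by
            have h1 : ((l / (2 * N)) ^ (-(p - 1)⁻¹)) ^ (1 - p) ≤ y ^ (1 - p) :=
              Real.rpow_le_rpow_of_nonpos hy h (by linarith)
            rw [← Real.rpow_mul (by positivity), show -(p - 1)⁻¹ * (1 - p) = 1 by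
              field_simp; ring, Real.rpow_one, div_le_iff₀ (by positivity)] at h1
            rw [hb]; linarith
          rw [Set.indicator_of_mem (show l ∈ Set.Ioc 0 b from ⟨hl, hlb⟩), mul_comm]
        · simp
    _ = ENNReal.ofReal (y ^ 2) * ∫⁻ l in Set.Ioc 0 b, ENNReal.ofReal (l ^ (q - 3)) := by
        rw [lintegral_indicator measurableSet_Ioc, Measure.restrict_restrict measurableSet_Ioc,
          Set.inter_eq_left.2 Set.Ioc_subset_Ioi_self,
          lintegral_const_mul' _ _ ENNReal.ofReal_ne_top]
    _ = _ := by
        rw [lintegral_Ioc_rpow hb0.le (by linarith), ← ENNReal.ofReal_mul (by positivity)]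
        congr 1
        rw [show q - 3 + 1 = q - 2 by ring, hb, Real.mul_rpow (by positivity) (by positivity),
          ← Real.rpow_mul hy.le, ← Real.rpow_natCast y 2,
          show y ^ p = y ^ ((2 : ℕ) : ℝ) * y ^ ((1 - p) * (q - 2)) by
            rw [← Real.rpow_add hy]; congr 1; push_cast; linarith]
        ring

/-- Layer-cake formula for `|F|^q`, the distribution bound at each height, then Tonelli. Strong
measurability of `f` makes the integrand jointly measurable in height and position. -/
theorem IsFourierTransform.lintegral_rpow_le_of_stronglyMeasurable {p q N : ℝ} (hp1 : 1 < p)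
    (hp2 : p < 2) (hpq : (p - 1) * (q - 1) = 1) {f F : EucSp n → ℂ} (hfm : StronglyMeasurable f)
    (hf : MemLp f (ENNReal.ofReal p) volume) (hF : IsFourierTransform f F)
    (hN : 0 < N) (hfN : ∫ x, ‖f x‖ ^ p ≤ N) :
    ∫⁻ ξ, ENNReal.ofReal (‖F ξ‖ ^ q) ≤ ENNReal.ofReal q * (4 * plancherelConst n ^ 2) *
      ENNReal.ofReal ((2 * N) ^ (q - 2) / (q - 2) * N) := by
  have hp : 0 < p - 1 := by linarith
  have hq : 2 < q := by nlinarith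
  -- The cutting level solves `a^{1-p} N = l / 2`, which makes the `L¹` norm of the large part at
  -- most `l / 2`.
  set a : ℝ → ℝ := fun l => (l / (2 * N)) ^ (-(p - 1)⁻¹) with ha
  set w : ℝ → EucSp n → ℝ≥0∞ := fun l x => ENNReal.ofReal (l ^ (q - 3)) *
    (if ‖f x‖ ≤ a l then ENNReal.ofReal (‖f x‖ ^ 2) else 0) with hw
  have hfm' : Measurable f := hfm.measurable
  have hwm : Measurable (Function.uncurry w) := by
    refine Measurable.mul (by fun_prop) (Measurable.ite ?_ (by fun_prop) measurable_const)
    exact measurableSet_le (by fun_prop) (by fun_prop)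
  have hK : 4 * plancherelConst n ^ 2 ≠ ∞ :=
    ENNReal.mul_ne_top (by norm_num) (ENNReal.pow_ne_top (plancherelConst_ne_top n))
  rw [lintegral_rpow_eq_lintegral_meas_lt_mul volume (.of_forall fun ξ => norm_nonneg (F ξ))
    hF.aestronglyMeasurable.norm.aemeasurable (by linarith : 0 < q), mul_assoc]
  gcongr
  calc ∫⁻ l in Set.Ioi (0 : ℝ), volume {ξ | l < ‖F ξ‖} * ENNReal.ofReal (l ^ (q - 1))
      ≤ ∫⁻ l in Set.Ioi (0 : ℝ), 4 * plancherelConst n ^ 2 * ∫⁻ x, w l x := by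
        refine setLIntegral_mono' measurableSet_Ioi fun l hl => ?_
        have hl : 0 < l := hl
        have hal : 0 < a l := Real.rpow_pos_of_pos (by positivity) _
        have hle : a l ^ (1 - p) * ∫ x, ‖f x‖ ^ p ≤ l / 2 := by
          rw [ha, ← Real.rpow_mul (by positivity), show -(p - 1)⁻¹ * (1 - p) = 1 by
              field_simp; ring, Real.rpow_one]
          calc l / (2 * N) * ∫ x, ‖f x‖ ^ p ≤ l / (2 * N) * N := by gcongr
            _ = l / 2 := by field_simp
        refine (mul_le_mul_left (hF.meas_lt_le hp1 hp2.le hf hal hl hle) _).trans_eq ?_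
        have e : ∫⁻ x, w l x = ENNReal.ofReal (l ^ (q - 3)) *
            ∫⁻ x, ‖{x | ‖f x‖ ≤ a l}.indicator f x‖ₑ ^ 2 := by
          rw [← lintegral_const_mul' _ _ ENNReal.ofReal_ne_top]
          refine lintegral_congr fun x => ?_
          simp only [hw, Set.indicator, Set.mem_ofPred_eq]
          split_ifs with h
          · rw [ENNReal.ofReal_pow (norm_nonneg _), ofReal_norm]
          · simp
        have e2 : ENNReal.ofReal (4 * l ^ (-2 : ℝ)) * ENNReal.ofReal (l ^ (q - 1)) =
            4 * ENNReal.ofReal (l ^ (q - 3)) := by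
          rw [← ENNReal.ofReal_mul (by positivity), mul_assoc, ← Real.rpow_add hl,
            ENNReal.ofReal_mul (by norm_num)]
          congr 2
          · simp
          · congr 1; ring
        rw [e]
        calc _ = plancherelConst n ^ 2 * (∫⁻ x, ‖{x | ‖f x‖ ≤ a l}.indicator f x‖ₑ ^ 2) *
              (ENNReal.ofReal (4 * l ^ (-2 : ℝ)) * ENNReal.ofReal (l ^ (q - 1))) := by ring
          _ = _ := by rw [e2]; ring
    _ = 4 * plancherelConst n ^ 2 * ∫⁻ x, ∫⁻ l in Set.Ioi (0 : ℝ), w l x := by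
        rw [lintegral_const_mul' _ _ hK, lintegral_lintegral_swap hwm.aemeasurable]
    _ ≤ 4 * plancherelConst n ^ 2 *
          ∫⁻ x, ENNReal.ofReal ((2 * N) ^ (q - 2) / (q - 2) * ‖f x‖ ^ p) := by
        gcongr with x
        exact lintegral_Ioi_indicator_small_le hp1 hp2 hpq hN (norm_nonneg (f x))
    _ ≤ 4 * plancherelConst n ^ 2 * ENNReal.ofReal ((2 * N) ^ (q - 2) / (q - 2) * N) := by
        have hc : 0 ≤ (2 * N) ^ (q - 2) / (q - 2) :=
          div_nonneg (by positivity) (by linarith)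
        gcongr
        rw [← ofReal_integral_eq_lintegral_ofReal ((hf.integrable_rpow (by linarith)).const_mul _)
          (.of_forall fun x => by positivity), integral_const_mul]
        gcongr

/-- The **Hausdorff–Young inequality**, up to the value of the constant. -/
theorem IsFourierTransform.exists_eLpNorm_le (n : ℕ) {p q : ℝ} (hp1 : 1 < p) (hp2 : p < 2)
    (hpq : 1 / p + 1 / q = 1) :
    ∃ C : ℝ≥0∞, C ≠ ∞ ∧ ∀ f F : EucSp n → ℂ, MemLp f (ENNReal.ofReal p) volume →
      IsFourierTransform f F →
      (∫⁻ ξ, ENNReal.ofReal (‖F ξ‖ ^ q)) ^ (1 / q) ≤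
        C * eLpNorm f (ENNReal.ofReal p) volume := by
  have hp0 : 0 < p := by linarith
  have hq0 : q ≠ 0 := by
    rintro rfl
    rw [div_zero, add_zero, div_eq_iff hp0.ne'] at hpq
    linarith
  have hpq' : (p - 1) * (q - 1) = 1 := by
    field_simp at hpq
    linarith
  have hq : 2 < q := by nlinarith
  set A : ℝ≥0∞ := ENNReal.ofReal q * (4 * plancherelConst n ^ 2) *
    ENNReal.ofReal (2 ^ (q - 2) / (q - 2)) with hA
  have hAtop : A ≠ ∞ := by
    refine ENNReal.mul_ne_top (ENNReal.mul_ne_top ENNReal.ofReal_ne_top ?_) ENNReal.ofReal_ne_top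
    exact ENNReal.mul_ne_top (by norm_num) (ENNReal.pow_ne_top (plancherelConst_ne_top n))
  have hN : ∀ f F : EucSp n → ℂ, MemLp f (ENNReal.ofReal p) volume → IsFourierTransform f F →
      ∀ N : ℝ, 0 < N → ∫ x, ‖f x‖ ^ p ≤ N →
      (∫⁻ ξ, ENNReal.ofReal (‖F ξ‖ ^ q)) ^ (1 / q) ≤
        A ^ (1 / q) * ENNReal.ofReal (N ^ (1 / p)) := by
    intro f F hf hF N hN hfN
    have hae := hf.1.ae_eq_mk
    have hfN' : ∫ x, ‖hf.1.mk f x‖ ^ p ≤ N := by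
      refine le_of_eq_of_le (integral_congr_ae ?_) hfN
      filter_upwards [hae] with x hx
      rw [hx]
    have h := (hF.congr_left hae).lintegral_rpow_le_of_stronglyMeasurable hp1 hp2 hpq'
      hf.1.stronglyMeasurable_mk ((memLp_congr_ae hae).1 hf) hN hfN'
    -- Here `q / p = q - 1`, so the bound is homogeneous of degree `q` in `N^{1/p}`.
    have e : (2 * N) ^ (q - 2) / (q - 2) * N = 2 ^ (q - 2) / (q - 2) * (N ^ (1 / p)) ^ q := by
      rw [Real.mul_rpow (by norm_num) hN.le, ← Real.rpow_mul hN.le,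
        show 1 / p * q = q - 2 + 1 by field_simp; linarith, Real.rpow_add hN, Real.rpow_one]
      ring
    have h2 : 0 ≤ (2 : ℝ) ^ (q - 2) / (q - 2) := div_nonneg (by positivity) (by linarith)
    rw [e, ENNReal.ofReal_mul h2, ← mul_assoc, ← hA,
      ← ENNReal.ofReal_rpow_of_nonneg (by positivity) (by linarith)] at h
    calc _ ≤ (A * ENNReal.ofReal (N ^ (1 / p)) ^ q) ^ (1 / q) :=
          ENNReal.rpow_le_rpow h (by positivity)
      _ = _ := by
          rw [ENNReal.mul_rpow_of_nonneg _ _ (by positivity), ← ENNReal.rpow_mul,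
            mul_one_div_cancel hq0, ENNReal.rpow_one]
  have hCtop : A ^ (1 / q) ≠ ∞ := ENNReal.rpow_ne_top_of_nonneg (by positivity) hAtop
  refine ⟨A ^ (1 / q), hCtop, fun f F hf hF => ?_⟩
  set I := ∫ x, ‖f x‖ ^ p with hI
  have hI0 : 0 ≤ I := integral_nonneg fun x => by positivity
  have hnorm : eLpNorm f (ENNReal.ofReal p) volume = ENNReal.ofReal (I ^ (1 / p)) := by
    rw [hf.eLpNorm_eq_integral_rpow_norm (by simpa using hp0) ENNReal.ofReal_ne_top,
      ENNReal.toReal_ofReal hp0.le, one_div]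
  rw [hnorm]
  -- Letting `N` decrease to `∫ |f|^p` also covers the case where this integral is zero, since the
  -- cutting level requires `N > 0`.
  have hlim : Filter.Tendsto (fun N : ℝ => A ^ (1 / q) * ENNReal.ofReal (N ^ (1 / p)))
      (nhdsWithin I (Set.Ioi I)) (nhds (A ^ (1 / q) * ENNReal.ofReal (I ^ (1 / p)))) := by
    refine ENNReal.Tendsto.const_mul ?_ (Or.inr hCtop)
    refine (ENNReal.continuous_ofReal.tendsto _).comp ?_
    exact ((Real.continuousAt_rpow_const I (1 / p) (Or.inr (by positivity))).tendsto).mono_left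
      nhdsWithin_le_nhds
  refine ge_of_tendsto hlim ?_
  filter_upwards [self_mem_nhdsWithin] with N hIN
  exact hN f F hf hF N (hI0.trans_lt hIN) (le_of_lt hIN)

end HausdorffYoung

/-! ### Convolution with a unimodular density against a finite measure. -/

section MeasureConvolution

open ContinuousLinearMap Convolution

variable {n : ℕ} {ν : Measure (EucSp n)} [IsFiniteMeasure ν] {φ : EucSp n → ℂ}

theorem norm_exp_neg_I_inner {n : ℕ} (x ξ : EucSp n) :
    ‖Complex.exp (-(Complex.I * ((inner ℝ x ξ : ℝ) : ℂ)))‖ = 1 := by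
  simp [Complex.norm_exp]

theorem integrable_of_norm_eq_one (hφ : Measurable φ) (h1 : ∀ y, ‖φ y‖ = 1) : Integrable φ ν :=
  Integrable.of_bound hφ.aestronglyMeasurable 1 (by simp [h1])

theorem aestronglyMeasurable_convolution (hφ : Measurable φ) {g : EucSp n → ℂ}
    (hg : AEStronglyMeasurable g volume) :
    AEStronglyMeasurable (φ ⋆[mul ℂ ℂ, ν] g) volume :=
  (AEStronglyMeasurable.convolution_integrand (mul ℂ ℂ) (ν := ν)
    hφ.aestronglyMeasurable hg).integral_prod_right'

/-- The map `(x, y) ↦ x - y` pulls Lebesgue null sets back to null sets of `volume.prod ν`, even for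
singular `ν`, by translation invariance. -/
theorem convolution_congr_ae {g g' : EucSp n → ℂ} (h : g =ᵐ[volume] g') :
    φ ⋆[mul ℂ ℂ, ν] g =ᵐ[volume] φ ⋆[mul ℂ ℂ, ν] g' := by
  have hq :=
    (quasiMeasurePreserving_sub_of_right_invariant (volume : Measure (EucSp n)) ν).ae_eq_comp h
  filter_upwards [Measure.ae_ae_of_ae_prod hq] with x hx
  refine integral_congr_ae ?_
  filter_upwards [hx] with y hy
  simp only [Function.comp_apply] at hy
  simp only [hy]

theorem integrable_convolution_of_norm_eq_one (hφ : Measurable φ) (h1 : ∀ y, ‖φ y‖ = 1)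
    {g : EucSp n → ℂ} (hg : Integrable g) : Integrable (φ ⋆[mul ℂ ℂ, ν] g) :=
  ((integrable_of_norm_eq_one hφ h1).convolution_integrand (mul ℂ ℂ) hg).integral_prod_left

theorem ae_convolutionExistsAt_of_integrable (hφ : Measurable φ) (h1 : ∀ y, ‖φ y‖ = 1)
    {g : EucSp n → ℂ} (hg : Integrable g) :
    ∀ᵐ x, ConvolutionExistsAt φ g x (mul ℂ ℂ) ν :=
  ((integrable_of_norm_eq_one hφ h1).convolution_integrand (mul ℂ ℂ) hg).prod_right_ae

theorem lintegral_lintegral_sub_sq (ν : Measure (EucSp n)) [IsFiniteMeasure ν]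
    {h : EucSp n → ℂ} (hh : AEStronglyMeasurable h volume) :
    ∫⁻ x, ∫⁻ y, ‖h (x - y)‖ₑ ^ 2 ∂ν = ν Set.univ * ∫⁻ x, ‖h x‖ₑ ^ 2 := by
  have hm : AEStronglyMeasurable (fun p : EucSp n × EucSp n => h (p.1 - p.2)) (volume.prod ν) :=
    hh.comp_quasiMeasurePreserving (quasiMeasurePreserving_sub_of_right_invariant _ ν)
  rw [lintegral_lintegral_swap (hm.enorm.pow_const 2)]
  have : ∀ y, ∫⁻ x, ‖h (x - y)‖ₑ ^ 2 = ∫⁻ x, ‖h x‖ₑ ^ 2 := fun y =>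
    lintegral_sub_right_eq_self (fun x => ‖h x‖ₑ ^ 2) y
  simp only [this, lintegral_const, mul_comm]

theorem ae_memLp_two_comp_sub (ν : Measure (EucSp n)) [IsFiniteMeasure ν]
    {h : EucSp n → ℂ} (hh : MemLp h 2 volume) :
    ∀ᵐ x, MemLp (fun y => h (x - y)) 2 ν := by
  have hm : AEStronglyMeasurable (fun p : EucSp n × EucSp n => h (p.1 - p.2)) (volume.prod ν) :=
    hh.1.comp_quasiMeasurePreserving (quasiMeasurePreserving_sub_of_right_invariant _ ν)
  have hfin : ∫⁻ x, ∫⁻ y, ‖h (x - y)‖ₑ ^ 2 ∂ν ≠ ∞ := by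
    rw [lintegral_lintegral_sub_sq ν hh.1, ← eLpNorm_two_sq]
    exact ENNReal.mul_ne_top (measure_ne_top _ _) (ENNReal.pow_ne_top hh.2.ne)
  filter_upwards [hm.prodMk_left, ae_lt_top' (hm.enorm.pow_const 2).lintegral_prod_right' hfin]
    with x hx1 hx2
  refine ⟨hx1, ?_⟩
  rw [← eLpNorm_two_sq] at hx2
  exact (ENNReal.pow_lt_top_iff.1 hx2).resolve_right two_ne_zero

theorem ae_convolutionExistsAt_of_memLp_two (hφ : Measurable φ) (h1 : ∀ y, ‖φ y‖ = 1)
    {h : EucSp n → ℂ} (hh : MemLp h 2 volume) :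
    ∀ᵐ x, ConvolutionExistsAt φ h x (mul ℂ ℂ) ν := by
  filter_upwards [ae_memLp_two_comp_sub ν hh] with x hx
  exact (hx.integrable (by norm_num)).bdd_mul (c := 1) hφ.aestronglyMeasurable (by simp [h1])

/-- Cauchy–Schwarz in `ν` costs one factor `ν Set.univ` in the squared norm, and Tonelli with
translation invariance a second. -/
theorem eLpNorm_two_convolution_le (h1 : ∀ y, ‖φ y‖ = 1)
    {h : EucSp n → ℂ} (hh : MemLp h 2 volume) :
    eLpNorm (φ ⋆[mul ℂ ℂ, ν] h) 2 volume ≤ ν Set.univ * eLpNorm h 2 volume := by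
  have key : ∫⁻ x, ‖(φ ⋆[mul ℂ ℂ, ν] h) x‖ₑ ^ 2 ≤
      ν Set.univ * ∫⁻ x, ∫⁻ y, ‖h (x - y)‖ₑ ^ 2 ∂ν := by
    rw [← lintegral_const_mul' _ _ (measure_ne_top _ _)]
    refine lintegral_mono_ae ?_
    filter_upwards [ae_memLp_two_comp_sub ν hh] with x hx
    have e1 : ‖(φ ⋆[mul ℂ ℂ, ν] h) x‖ₑ ≤ eLpNorm (fun y => h (x - y)) 1 ν := by
      rw [eLpNorm_one_eq_lintegral_enorm]
      refine (enorm_integral_le_lintegral_enorm _).trans_eq ?_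
      refine lintegral_congr fun y => ?_
      rw [mul_apply', enorm_mul, ← ofReal_norm (φ y), h1]
      simp
    have e2 := eLpNorm_le_eLpNorm_mul_rpow_measure_univ (p := 1) (q := 2) (by norm_num) hx.1
    calc _ ≤ (eLpNorm (fun y => h (x - y)) 2 ν * ν Set.univ ^ (1 / (1 : ℝ≥0∞).toReal -
          1 / (2 : ℝ≥0∞).toReal)) ^ 2 := by
          gcongr
          exact e1.trans e2
      _ = _ := by
          rw [mul_pow, eLpNorm_two_sq, ← ENNReal.rpow_natCast (ν Set.univ ^ _),
            ← ENNReal.rpow_mul, mul_comm]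
          norm_num
  rw [lintegral_lintegral_sub_sq ν hh.1, ← eLpNorm_two_sq, ← eLpNorm_two_sq, ← mul_assoc, ← sq,
    ← mul_pow] at key
  exact (ENNReal.pow_le_pow_left_iff two_ne_zero).1 key

theorem memLp_two_convolution (hφ : Measurable φ) (h1 : ∀ y, ‖φ y‖ = 1)
    {h : EucSp n → ℂ} (hh : MemLp h 2 volume) : MemLp (φ ⋆[mul ℂ ℂ, ν] h) 2 volume :=
  ⟨aestronglyMeasurable_convolution hφ hh.1, (eLpNorm_two_convolution_le h1 hh).trans_lt
    (ENNReal.mul_lt_top (measure_lt_top _ _) hh.2)⟩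

/-- The Fourier transform of the complex measure with density `φ` with respect to `ν`. -/
noncomputable def densityFourier (ν : Measure (EucSp n)) (φ : EucSp n → ℂ) (ξ : EucSp n) : ℂ :=
  ∫ y, φ y * Complex.exp (-(Complex.I * ((inner ℝ y ξ : ℝ) : ℂ))) ∂ν

theorem enorm_densityFourier_le {ρ : Measure (EucSp n)} (h1 : ∀ y, ‖φ y‖ = 1) (ξ : EucSp n) :
    ‖densityFourier ρ φ ξ‖ₑ ≤ ρ Set.univ := by
  refine (enorm_integral_le_lintegral_enorm _).trans_eq ?_
  have : ∀ y, ‖φ y * Complex.exp (-(Complex.I * ((inner ℝ y ξ : ℝ) : ℂ)))‖ₑ = 1 := fun y => by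
    rw [← ofReal_norm, norm_mul, h1, norm_exp_neg_I_inner]
    simp
  simp [this]

theorem continuous_densityFourier (hφ : Measurable φ) (h1 : ∀ y, ‖φ y‖ = 1) :
    Continuous (densityFourier ν φ) := by
  refine continuous_of_dominated (bound := fun _ => 1) (fun ξ => ?_) (fun ξ => .of_forall fun y => ?_)
    (integrable_const _) (.of_forall fun y => by fun_prop)
  · exact (hφ.mul (by fun_prop)).aestronglyMeasurable
  · rw [norm_mul, h1, norm_exp_neg_I_inner, one_mul]

theorem fourierLOne_convolution (hφ : Measurable φ) (h1 : ∀ y, ‖φ y‖ = 1)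
    {g : EucSp n → ℂ} (hg : Integrable g) :
    fourierLOne (φ ⋆[mul ℂ ℂ, ν] g) = densityFourier ν φ * fourierLOne g := by
  ext ξ
  have hint := (integrable_of_norm_eq_one (ν := ν) hφ h1).convolution_integrand (mul ℂ ℂ) hg
  have hswap : Integrable (fun p : EucSp n × EucSp n =>
      Complex.exp (-(Complex.I * ((inner ℝ p.1 ξ : ℝ) : ℂ))) * (φ p.2 * g (p.1 - p.2)))
      (volume.prod ν) :=
    hint.bdd_mul (c := 1) (by fun_prop) (.of_forall fun p => (norm_exp_neg_I_inner _ _).le)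
  calc fourierLOne (φ ⋆[mul ℂ ℂ, ν] g) ξ
      = ∫ x, ∫ y, Complex.exp (-(Complex.I * ((inner ℝ x ξ : ℝ) : ℂ))) *
          (φ y * g (x - y)) ∂ν := by
        simp only [fourierLOne, convolution_def, mul_apply', integral_const_mul]
    _ = ∫ y, (∫ x, Complex.exp (-(Complex.I * ((inner ℝ x ξ : ℝ) : ℂ))) *
          (φ y * g (x - y))) ∂ν := integral_integral_swap hswap
    _ = ∫ y, φ y * Complex.exp (-(Complex.I * ((inner ℝ y ξ : ℝ) : ℂ))) *
          fourierLOne g ξ ∂ν := by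
        refine integral_congr_ae (.of_forall fun y => ?_)
        have e := integral_sub_right_eq_self (μ := volume) (fun x =>
          φ y * Complex.exp (-(Complex.I * ((inner ℝ y ξ : ℝ) : ℂ))) *
            (Complex.exp (-(Complex.I * ((inner ℝ x ξ : ℝ) : ℂ))) * g x)) y
        simp only [fourierLOne]
        rw [← integral_const_mul, ← e]
        refine integral_congr_ae (.of_forall fun x => ?_)
        have : Complex.exp (-(Complex.I * ((inner ℝ x ξ : ℝ) : ℂ))) =
            Complex.exp (-(Complex.I * ((inner ℝ y ξ : ℝ) : ℂ))) *
              Complex.exp (-(Complex.I * ((inner ℝ (x - y) ξ : ℝ) : ℂ))) := by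
          rw [← Complex.exp_add, inner_sub_left]
          congr 1
          push_cast
          ring
        simp only [this]
        ring
    _ = _ := integral_mul_const _ _

/-- Both sides are bounded and additive on `L²` and agree on `L¹ ∩ L²` by Fubini; compactly
supported continuous functions are dense. -/
theorem fourierLTwo_convolution (hφ : Measurable φ) (h1 : ∀ y, ‖φ y‖ = 1)
    {h : EucSp n → ℂ} (hh : MemLp h 2 volume) :
    fourierLTwo (φ ⋆[mul ℂ ℂ, ν] h) =ᵐ[volume] densityFourier ν φ * fourierLTwo h := by
  set m := densityFourier ν φ with hm
  have hmc : Continuous m := continuous_densityFourier hφ h1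
  have hmeas : ∀ {u : EucSp n → ℂ}, MemLp u 2 volume →
      AEStronglyMeasurable (m * fourierLTwo u) volume := fun hu =>
    hmc.aestronglyMeasurable.mul (aestronglyMeasurable_fourierLTwo hu)
  have hbound : ∀ {u : EucSp n → ℂ}, MemLp u 2 volume →
      eLpNorm (fourierLTwo (φ ⋆[mul ℂ ℂ, ν] u) - m * fourierLTwo u) 2 volume ≤
        2 * (plancherelConst n * ν Set.univ) * eLpNorm u 2 volume := by
    intro u hu
    have hTu := memLp_two_convolution (ν := ν) hφ h1 hu
    refine (eLpNorm_sub_le (aestronglyMeasurable_fourierLTwo hTu) (hmeas hu) (by norm_num)).trans ?_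
    have e1 : eLpNorm (fourierLTwo (φ ⋆[mul ℂ ℂ, ν] u)) 2 volume ≤
        plancherelConst n * ν Set.univ * eLpNorm u 2 volume := by
      rw [eLpNorm_fourierLTwo hTu, mul_assoc]
      gcongr
      exact eLpNorm_two_convolution_le h1 hu
    have e2 : eLpNorm (m * fourierLTwo u) 2 volume ≤
        plancherelConst n * ν Set.univ * eLpNorm u 2 volume := by
      have : eLpNorm (m * fourierLTwo u) 2 volume ≤
          ((ν Set.univ).toNNReal : ℝ≥0∞) * eLpNorm (fourierLTwo u) 2 volume := by
        refine eLpNorm_le_nnreal_smul_eLpNorm_of_ae_le_mul (.of_forall fun ξ => ?_) 2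
        have := enorm_densityFourier_le (ρ := ν) h1 ξ
        rw [Pi.mul_apply, nnnorm_mul]
        gcongr
        rw [← ENNReal.coe_le_coe, ENNReal.coe_toNNReal (measure_ne_top _ _)]
        exact this
      rw [ENNReal.coe_toNNReal (measure_ne_top _ _), eLpNorm_fourierLTwo hu] at this
      refine this.trans_eq (by ring)
    calc _ ≤ _ := add_le_add e1 e2
      _ = _ := by ring
  set K := 2 * (plancherelConst n * ν Set.univ) with hK
  have hKtop : K ≠ ∞ := ENNReal.mul_ne_top (by norm_num)
    (ENNReal.mul_ne_top (plancherelConst_ne_top n) (measure_ne_top _ _))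
  have hsmall : ∀ ε : ℝ≥0∞, ε ≠ 0 →
      eLpNorm (fourierLTwo (φ ⋆[mul ℂ ℂ, ν] h) - m * fourierLTwo h) 2 volume ≤ K * ε := by
    intro ε hε
    obtain ⟨g, hgc, hgε, hgcont, hg2⟩ :=
      hh.exists_hasCompactSupport_eLpNorm_sub_le (by norm_num) hε
    have hgi : Integrable g := hgcont.integrable_of_hasCompactSupport hgc
    have hTg := memLp_two_convolution (ν := ν) hφ h1 hg2
    have hTgi : Integrable (φ ⋆[mul ℂ ℂ, ν] g) :=
      integrable_convolution_of_norm_eq_one hφ h1 hgi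
    have hu := hh.sub hg2
    have hTu := memLp_two_convolution (ν := ν) hφ h1 hu
    have hTsplit : φ ⋆[mul ℂ ℂ, ν] h =ᵐ[volume]
        φ ⋆[mul ℂ ℂ, ν] (h - g) + φ ⋆[mul ℂ ℂ, ν] g := by
      filter_upwards [ae_convolutionExistsAt_of_memLp_two (ν := ν) hφ h1 hu,
        ae_convolutionExistsAt_of_memLp_two (ν := ν) hφ h1 hg2] with x hx1 hx2
      rw [Pi.add_apply, ← hx1.distrib_add hx2, sub_add_cancel]
    have hgood : fourierLTwo (φ ⋆[mul ℂ ℂ, ν] g) =ᵐ[volume] m * fourierLTwo g := by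
      refine (fourierLTwo_ae_eq_fourierLOne hTgi hTg).trans ?_
      rw [fourierLOne_convolution hφ h1 hgi]
      filter_upwards [fourierLTwo_ae_eq_fourierLOne hgi hg2] with ξ hξ
      rw [Pi.mul_apply, Pi.mul_apply, hξ]
    -- The defect of the identity vanishes at `g`, so its value at `h` is its value at `h - g`,
    -- which `hbound` makes small.
    have hdiff : fourierLTwo (φ ⋆[mul ℂ ℂ, ν] h) - m * fourierLTwo h =ᵐ[volume]
        fourierLTwo (φ ⋆[mul ℂ ℂ, ν] (h - g)) - m * fourierLTwo (h - g) := by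
      rw [fourierLTwo_congr (memLp_two_convolution hφ h1 hh) hTsplit]
      filter_upwards [fourierLTwo_add hTu hTg, hgood, fourierLTwo_sub hh hg2] with ξ a b c
      simp only [Pi.add_apply, Pi.sub_apply, Pi.mul_apply] at *
      rw [a, b, c]
      ring
    rw [eLpNorm_congr_ae hdiff]
    refine (hbound hu).trans ?_
    gcongr
  have hzero : eLpNorm (fourierLTwo (φ ⋆[mul ℂ ℂ, ν] h) - m * fourierLTwo h) 2 volume = 0 := by
    refine le_antisymm ?_ bot_le
    have hlim : Filter.Tendsto (fun ε : ℝ≥0∞ => K * ε) (nhdsWithin 0 {0}ᶜ) (nhds 0) := by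
      have := (ENNReal.Tendsto.const_mul (a := K) (Filter.tendsto_id (x := nhds (0 : ℝ≥0∞)))
        (Or.inr hKtop)).mono_left (nhdsWithin_le_nhds (s := {0}ᶜ))
      simpa using this
    have : Filter.NeBot (nhdsWithin (0 : ℝ≥0∞) {0}ᶜ) := inferInstance
    refine ge_of_tendsto hlim ?_
    filter_upwards [self_mem_nhdsWithin] with ε hε
    exact hsmall ε hε
  rw [eLpNorm_eq_zero_iff ((aestronglyMeasurable_fourierLTwo
    (memLp_two_convolution hφ h1 hh)).sub (hmeas hh)) (by norm_num)] at hzero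
  filter_upwards [hzero] with ξ hξ
  exact sub_eq_zero.1 hξ

theorem IsFourierTransform.convolution (hφ : Measurable φ) (h1 : ∀ y, ‖φ y‖ = 1)
    {f F : EucSp n → ℂ} (hF : IsFourierTransform f F) :
    IsFourierTransform (φ ⋆[mul ℂ ℂ, ν] f) (densityFourier ν φ * F) := by
  obtain ⟨g, h, hg, hh, hf, hF⟩ := hF
  refine ⟨φ ⋆[mul ℂ ℂ, ν] g, φ ⋆[mul ℂ ℂ, ν] h,
    integrable_convolution_of_norm_eq_one hφ h1 hg,
    memLp_two_convolution hφ h1 hh, ?_, ?_⟩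
  · refine (convolution_congr_ae hf).trans ?_
    filter_upwards [ae_convolutionExistsAt_of_integrable (ν := ν) hφ h1 hg,
      ae_convolutionExistsAt_of_memLp_two (ν := ν) hφ h1 hh] with x hx1 hx2
    rw [Pi.add_apply, ← hx1.distrib_add hx2]
  · rw [fourierLOne_convolution hφ h1 hg]
    filter_upwards [hF, fourierLTwo_convolution (ν := ν) hφ h1 hh] with ξ a b
    simp only [Pi.add_apply, Pi.mul_apply] at *
    rw [a, b, mul_add]

end MeasureConvolution

/-! ### The Fourier multiplier of `M^t_μ - 1`. -/

section DilatedMean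

open ContinuousLinearMap Convolution

variable {n : ℕ}

/-- The dilated mean is the convolution with a unimodular density against a finite measure whose
Fourier transform is the dilation of that of `μ`. -/
theorem exists_dilatedMean_eq_convolution (μ : ComplexMeasure (EucSp n)) {t : ℝ} (ht : 0 < t) :
    ∃ (ν : Measure (EucSp n)) (φ : EucSp n → ℂ), IsFiniteMeasure ν ∧ Measurable φ ∧
      (∀ y, ‖φ y‖ = 1) ∧ (∀ f, dilatedMean μ t f = φ ⋆[mul ℂ ℂ, ν] f) ∧
      ∀ ξ, densityFourier ν φ ξ = measureFourier μ (t • ξ) := by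
  obtain ⟨φ, hφ, h1, hint⟩ := μ.exists_integral_eq
  set e : EucSp n ≃ᵐ EucSp n := MeasurableEquiv.smul₀ t ht.ne' with he
  have het : ∀ y, e y = t • y := fun y => rfl
  -- Pushing the variation forward under `y ↦ t y` and undoing the dilation in the density absorbs
  -- `t` into the measure.
  refine ⟨μ.variation.map e, fun z => φ (t⁻¹ • z), inferInstance,
    hφ.comp (measurable_const_smul _), fun y => h1 _, fun f => ?_, fun ξ => ?_⟩
  · ext x
    rw [dilatedMean, hint, convolution_def, e.measurableEmbedding.integral_map]
    refine integral_congr_ae (.of_forall fun y => ?_)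
    simp only [het, smul_smul, inv_mul_cancel₀ ht.ne', one_smul, mul_apply']
  · rw [densityFourier, measureFourier, hint, e.measurableEmbedding.integral_map]
    refine integral_congr_ae (.of_forall fun y => ?_)
    simp only [het, smul_smul, inv_mul_cancel₀ ht.ne', one_smul, inner_smul_left,
      inner_smul_right]
    simp

theorem IsFourierTransform.dilatedMean_sub (μ : ComplexMeasure (EucSp n)) {t : ℝ} (ht : 0 < t)
    {f F : EucSp n → ℂ} (hF : IsFourierTransform f F) :
    IsFourierTransform (fun x => dilatedMean μ t f x - f x)
      (fun ξ => (measureFourier μ (t • ξ) - 1) * F ξ) := by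
  obtain ⟨ν, φ, _, hφ, h1, hconv, hm⟩ := exists_dilatedMean_eq_convolution μ ht
  have := (hF.convolution (ν := ν) hφ h1).sub hF
  have e : (fun ξ => (measureFourier μ (t • ξ) - 1) * F ξ) = densityFourier ν φ * F - F := by
    ext ξ
    simp only [Pi.sub_apply, Pi.mul_apply, hm]
    ring
  rw [e, hconv]
  exact this

theorem aestronglyMeasurable_dilatedMean_sub (μ : ComplexMeasure (EucSp n)) {t : ℝ} (ht : 0 < t)
    {f : EucSp n → ℂ} (hf : AEStronglyMeasurable f volume) :
    AEStronglyMeasurable (fun x => dilatedMean μ t f x - f x) volume := by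
  obtain ⟨ν, φ, _, hφ, h1, hconv, -⟩ := exists_dilatedMean_eq_convolution μ ht
  rw [hconv]
  exact (aestronglyMeasurable_convolution hφ hf).sub hf

theorem memLp_two_dilatedMean_sub (μ : ComplexMeasure (EucSp n)) {t : ℝ} (ht : 0 < t)
    {f : EucSp n → ℂ} (hf : MemLp f 2 volume) :
    MemLp (fun x => dilatedMean μ t f x - f x) 2 volume := by
  obtain ⟨ν, φ, _, hφ, h1, hconv, -⟩ := exists_dilatedMean_eq_convolution μ ht
  rw [hconv]
  exact (memLp_two_convolution hφ h1 hf).sub hf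

theorem fourierLOne_dilatedMean_sub (μ : ComplexMeasure (EucSp n)) {t : ℝ} (ht : 0 < t)
    {f : EucSp n → ℂ} (hf : Integrable f) (ξ : EucSp n) :
    fourierLOne (fun x => dilatedMean μ t f x - f x) ξ =
      (measureFourier μ (t • ξ) - 1) * fourierLOne f ξ := by
  obtain ⟨ν, φ, _, hφ, h1, hconv, hm⟩ := exists_dilatedMean_eq_convolution μ ht
  rw [hconv]
  have := congrFun (fourierLOne_sub (integrable_convolution_of_norm_eq_one (ν := ν) hφ h1 hf) hf) ξ
  rw [fourierLOne_convolution hφ h1 hf] at this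
  refine this.trans ?_
  simp only [Pi.sub_apply, Pi.mul_apply, hm]
  ring

/-- Capping at `1` commutes with nonnegative powers, which lets the weights in the `L^{p'}` and `L²`
estimates be pulled inside the power. -/
theorem min_one_rpow_mul_rpow {s r c y : ℝ} (hs : 0 ≤ s) (hc : 0 ≤ c) (hy : 0 ≤ y) :
    min 1 (s ^ (r * c)) * y ^ c = (min 1 (s ^ r) * y) ^ c := by
  have h0 : 0 ≤ min 1 (s ^ r) := by positivity
  rw [Real.mul_rpow h0 hy, Real.rpow_mul hs]
  congr 1
  rcases le_total 1 (s ^ r) with h | h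
  · rw [min_eq_left h, Real.one_rpow, min_eq_left (Real.one_le_rpow h hc)]
  · rw [min_eq_right h, min_eq_right (Real.rpow_le_one (by positivity) h hc)]

theorem lintegral_rpow_mul_le {q a : ℝ} (hq : 0 < q) (ha : 0 < a) {u v : EucSp n → ℝ}
    (hu : ∀ ξ, 0 ≤ u ξ) (huv : ∀ᵐ ξ, a * u ξ ≤ v ξ) :
    (∫⁻ ξ, ENNReal.ofReal (u ξ ^ q)) ^ (1 / q) ≤
      ENNReal.ofReal a⁻¹ * (∫⁻ ξ, ENNReal.ofReal (v ξ ^ q)) ^ (1 / q) := by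
  have hle : ∫⁻ ξ, ENNReal.ofReal (u ξ ^ q) ≤
      ENNReal.ofReal a⁻¹ ^ q * ∫⁻ ξ, ENNReal.ofReal (v ξ ^ q) := by
    rw [← lintegral_const_mul' _ _ (ENNReal.rpow_ne_top_of_nonneg hq.le ENNReal.ofReal_ne_top)]
    refine lintegral_mono_ae ?_
    filter_upwards [huv] with ξ hξ
    have hv : 0 ≤ v ξ := (mul_nonneg ha.le (hu ξ)).trans hξ
    rw [ENNReal.ofReal_rpow_of_nonneg (by positivity) hq.le,
      ← ENNReal.ofReal_mul (by positivity), ← Real.mul_rpow (by positivity) hv]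
    refine ENNReal.ofReal_le_ofReal (Real.rpow_le_rpow (hu ξ) ?_ hq.le)
    rwa [← div_eq_inv_mul, le_div_iff₀' ha]
  calc _ ≤ (ENNReal.ofReal a⁻¹ ^ q * ∫⁻ ξ, ENNReal.ofReal (v ξ ^ q)) ^ (1 / q) :=
        ENNReal.rpow_le_rpow hle (by positivity)
    _ = _ := by
        rw [ENNReal.mul_rpow_of_nonneg _ _ (by positivity), ← ENNReal.rpow_mul,
          mul_one_div_cancel hq.ne', ENNReal.rpow_one]

theorem IsFourierTransform.plancherel {f F : EucSp n → ℂ} (hf : MemLp f 2 volume)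
    (hF : IsFourierTransform f F) :
    (∫⁻ ξ, ENNReal.ofReal (‖F ξ‖ ^ (2 : ℝ))) ^ (1 / 2 : ℝ) =
      plancherelConst n * eLpNorm f 2 volume := by
  rw [← eLpNorm_fourierLTwo hf, eLpNorm_eq_lintegral_rpow_enorm_toReal (by norm_num) (by norm_num)]
  simp only [ENNReal.toReal_ofNat]
  congr 1
  refine lintegral_congr_ae ?_
  filter_upwards [hF.unique (isFourierTransform_fourierLTwo hf)] with ξ hξ
  rw [hξ, ← ofReal_norm, ENNReal.ofReal_rpow_of_nonneg (norm_nonneg _) (by norm_num)]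

end DilatedMean

/-! ### The three estimates. -/

theorem mainTheorem1 (n : ℕ) (hn : 2 ≤ n) (σ : ℝ) (μ : ComplexMeasure (EucSp n))
    (hμ : IsClassK σ μ) :
    (∃ c : ℝ, 0 < c ∧ ∀ f : EucSp n → ℂ, MemLp f 1 volume → ∀ t : ℝ, 0 < t →
      (⨆ ξ : EucSp n, ENNReal.ofReal (min 1 ((t * ‖ξ‖) ^ (2 * σ)) * ‖fourierOfLp f ξ‖)) ≤
        ENNReal.ofReal c * eLpNorm (fun x => dilatedMean μ t f x - f x) 1 volume) ∧
    (∀ p p' : ℝ, 1 < p → p < 2 → 1 / p + 1 / p' = 1 →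
      ∃ c : ℝ, 0 < c ∧ ∀ f : EucSp n → ℂ, MemLp f (ENNReal.ofReal p) volume → ∀ t : ℝ, 0 < t →
        (∫⁻ ξ : EucSp n, ENNReal.ofReal
            (min 1 ((t * ‖ξ‖) ^ (2 * σ * p')) * ‖fourierOfLp f ξ‖ ^ p')) ^ (1 / p') ≤
          ENNReal.ofReal c *
            eLpNorm (fun x => dilatedMean μ t f x - f x) (ENNReal.ofReal p) volume) ∧
    (∃ c C : ℝ, 0 < c ∧ 0 < C ∧ ∀ f : EucSp n → ℂ, MemLp f 2 volume → ∀ t : ℝ, 0 < t →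
      ENNReal.ofReal c * eLpNorm (fun x => dilatedMean μ t f x - f x) 2 volume ≤
        (∫⁻ ξ : EucSp n, ENNReal.ofReal
            (min 1 ((t * ‖ξ‖) ^ (4 * σ)) * ‖fourierOfLp f ξ‖ ^ 2)) ^ (1 / 2 : ℝ) ∧
      (∫⁻ ξ : EucSp n, ENNReal.ofReal
            (min 1 ((t * ‖ξ‖) ^ (4 * σ)) * ‖fourierOfLp f ξ‖ ^ 2)) ^ (1 / 2 : ℝ) ≤
        ENNReal.ofReal C * eLpNorm (fun x => dilatedMean μ t f x - f x) 2 volume) := by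
  obtain ⟨a, b, ha, hb, hab⟩ := hμ.estimate
  have hnorm : ∀ {t : ℝ}, 0 < t → ∀ ξ : EucSp n, ‖t • ξ‖ = t * ‖ξ‖ := fun ht ξ => by
    rw [norm_smul, Real.norm_of_nonneg ht.le]
  have hlow : ∀ {t : ℝ}, 0 < t → ∀ (ξ : EucSp n) (z : ℂ),
      a * (min 1 ((t * ‖ξ‖) ^ (2 * σ)) * ‖z‖) ≤ ‖(measureFourier μ (t • ξ) - 1) * z‖ := by
    intro t ht ξ z
    rw [norm_mul, ← mul_assoc, norm_sub_rev, ← hnorm ht]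
    exact mul_le_mul_of_nonneg_right (hab _).1 (norm_nonneg _)
  have hupp : ∀ {t : ℝ}, 0 < t → ∀ (ξ : EucSp n) (z : ℂ),
      b⁻¹ * ‖(measureFourier μ (t • ξ) - 1) * z‖ ≤ min 1 ((t * ‖ξ‖) ^ (2 * σ)) * ‖z‖ := by
    intro t ht ξ z
    rw [norm_mul, ← mul_assoc, norm_sub_rev, ← hnorm ht]
    refine mul_le_mul_of_nonneg_right ?_ (norm_nonneg _)
    rw [← div_eq_inv_mul, div_le_iff₀' hb]
    exact (hab _).2
  have hu : ∀ {t : ℝ}, 0 < t → ∀ (ξ : EucSp n) (z : ℂ),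
      0 ≤ min 1 ((t * ‖ξ‖) ^ (2 * σ)) * ‖z‖ := fun ht ξ z => by positivity
  refine ⟨⟨a⁻¹, by positivity, fun f hf t ht => iSup_le fun ξ => ?_⟩, ?_, ?_⟩
  -- The supremum runs over every frequency, so the multiplier identity is used here in its
  -- pointwise form for integrable functions.
  · have hi : Integrable f := memLp_one_iff_integrable.1 hf
    rw [fourierOfLp, if_pos hi]
    refine le_trans ?_ (mul_le_mul_right (enorm_fourierLOne_le _ ξ) _)
    rw [fourierLOne_dilatedMean_sub μ ht hi, ← ofReal_norm, ← ENNReal.ofReal_mul (by positivity)]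
    refine ENNReal.ofReal_le_ofReal ?_
    rw [← div_eq_inv_mul, le_div_iff₀' ha]
    exact hlow ht ξ _
  · intro p q hp1 hp2 hpq
    obtain ⟨C, hC, hHY⟩ := IsFourierTransform.exists_eLpNorm_le n hp1 hp2 hpq
    have hq : 0 < q := by
      have h1 : 1 / p < 1 := by rw [div_lt_one (by linarith)]; exact hp1
      have h2 : 0 < 1 / q := by linarith
      exact one_div_pos.1 h2
    -- The `+ 1` keeps the constant positive: `C` is only known to be finite.
    refine ⟨a⁻¹ * (C.toReal + 1), by positivity, fun f hf t ht => ?_⟩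
    have hF := isFourierTransform_fourierOfLp hp1.le hp2.le hf
    have hmeas := aestronglyMeasurable_dilatedMean_sub μ ht hf.1
    -- An infinite right-hand side makes the claim trivial, so no `L^p` bound for the convolution is
    -- needed.
    by_cases hfin : eLpNorm (fun x => dilatedMean μ t f x - f x) (ENNReal.ofReal p) volume = ∞
    · rw [hfin, ENNReal.mul_top]
      · exact le_top
      · simp only [ne_eq, ENNReal.ofReal_eq_zero, not_le]
        positivity
    have hHY' := hHY _ _ ⟨hmeas, lt_top_iff_ne_top.2 hfin⟩ (hF.dilatedMean_sub μ ht)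
    have e : ∀ ξ, min 1 ((t * ‖ξ‖) ^ (2 * σ * q)) * ‖fourierOfLp f ξ‖ ^ q =
        (min 1 ((t * ‖ξ‖) ^ (2 * σ)) * ‖fourierOfLp f ξ‖) ^ q := fun ξ =>
      min_one_rpow_mul_rpow (by positivity) hq.le (norm_nonneg _)
    simp only [e]
    refine (lintegral_rpow_mul_le hq ha (fun ξ => hu ht ξ _)
      (.of_forall fun ξ => hlow ht ξ _)).trans ?_
    rw [ENNReal.ofReal_mul (by positivity), mul_assoc]
    gcongr
    refine hHY'.trans ?_
    gcongr
    rw [ENNReal.ofReal_add ENNReal.toReal_nonneg zero_le_one, ENNReal.ofReal_toReal hC]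
    exact le_self_add
  · have hK0 : 0 < (plancherelConst n).toReal :=
      ENNReal.toReal_pos (plancherelConst_ne_zero n) (plancherelConst_ne_top n)
    -- Each constant is the Plancherel factor divided by the multiplier bound used: `b` for the
    -- lower estimate and `a` for the upper one.
    refine ⟨b⁻¹ * (plancherelConst n).toReal, a⁻¹ * (plancherelConst n).toReal, by positivity,
      by positivity, fun f hf t ht => ?_⟩
    have hf2 : MemLp f (ENNReal.ofReal 2) volume := by simpa using hf
    have hF := isFourierTransform_fourierOfLp one_le_two le_rfl hf2
    have hP := (hF.dilatedMean_sub μ ht).plancherel (memLp_two_dilatedMean_sub μ ht hf)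
    have e : ∀ ξ, min 1 ((t * ‖ξ‖) ^ (4 * σ)) * ‖fourierOfLp f ξ‖ ^ 2 =
        (min 1 ((t * ‖ξ‖) ^ (2 * σ)) * ‖fourierOfLp f ξ‖) ^ (2 : ℝ) := fun ξ => by
      rw [← min_one_rpow_mul_rpow (by positivity) zero_le_two (norm_nonneg _), Real.rpow_two,
        show 2 * σ * 2 = 4 * σ by ring]
    simp only [e]
    rw [ENNReal.ofReal_mul (by positivity), ENNReal.ofReal_mul (by positivity), mul_assoc,
      mul_assoc, ENNReal.ofReal_toReal (plancherelConst_ne_top n), ← hP]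
    refine ⟨?_, lintegral_rpow_mul_le two_pos ha (fun ξ => hu ht ξ _)
      (.of_forall fun ξ => hlow ht ξ _)⟩
    have h := lintegral_rpow_mul_le (q := 2) (a := b⁻¹) two_pos (by positivity)
      (fun ξ => norm_nonneg ((measureFourier μ (t • ξ) - 1) * fourierOfLp f ξ))
      (.of_forall fun ξ => hupp ht ξ _)
    rw [inv_inv] at h
    rw [ENNReal.ofReal_inv_of_pos hb, ENNReal.inv_mul_le_iff (by simpa using hb)
      ENNReal.ofReal_ne_top]
    exact h
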